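/- Let $\mathbb{F}$ be a field of characteristic different from $2$. A symplectic alternating algebra (SAA) over $\mathbb{F}$ is an $\mathbb{F}$-vector space $L$ with a non-degenerate alternating bilinear form $(\cdot,\cdot)$ and an alternating bilinear product such that $(xy,z)=(yz,x)$ for all $x,y,z\in L$; an isomorphism of SAAs is a linear bijection preserving the form and the product. Put $L^1=L$, $L^{n+1}=L^nL$ (linear span of products); $L$ is nilpotent if $L^n=0$ for some $n$, and $Z(L)=\{z\in L: zu=0\text{ for all }u\in L\}$. Consider nilpotent SAAs $L$ of dimension $10$ whose centre $Z(L)$ is isotropic of dimension $4$ and for which $L^3=Z(L)$. For $z\in L^2$ there is a well-defined alternating form $\varphi_z$ on $L/L^2$, $\varphi_z(u+L^2,v+L^2)=(zu,v)$, which depends only on $z+Z(L)$. Such an $L$ is said to be of type C if $\varphi_z$ is non-degenerate for every $z\in L^2\setminus Z(L)$. A standard basis of a $10$-dimensional SAA is a basis $x_1,\dots,x_5,y_1,\dots,y_5$ with $(x_i,x_j)=(y_i,y_j)=0$ and $(x_i,y_j)=\delta_{ij}$. For $\beta\in\mathbb{F}$, an SAA has the presentation $$\mathcal{P}(\beta):\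 (x_1y_2,y_3)=1,\quad (x_1y_4,y_5)=\beta,\quad (y_1y_2,y_5)=1,\quad (y_1y_3,y_4)=1$$ if it has a standard basis for which these equalities hold, all other values $(x_iy_j,y_k)$ and $(y_iy_j,y_k)$ with $1\le i<j<k\le 5$ are $0$, $x_ix_j=0$ for all $i,j$, and $x_iy_j=0$ for $j\le i$. Write $-\mathbb{F}^2=\{-c^2: c\in\mathbb{F}\}$. Then: 1. Every $L$ of type C has a presentation $\mathcal{P}(\beta)$ for some $\beta\in\mathbb{F}\setminus(-\mathbb{F}^2)$. 2. Conversely, for every $\beta\in\mathbb{F}\setminus(-\mathbb{F}^2)$ there is an SAA with presentation $\mathcal{P}(\beta)$, and every SAA with presentation $\mathcal{P}(\beta)$ is (a nilpotent SAA of dimension $10$ with isotropic centre of dimension $4$, with $L^3=Z(L)$, and) of type C. 3. Let $\beta,\tilde\beta\in\mathbb{F}\setminus(-\mathbb{F}^2)$. Two SAAs with presentations $\mathcal{P}(\beta)$ and $\mathcal{P}(\tilde\beta)$ respectively are isomorphic if and only if $$\tilde\beta/\beta=(a^2+b^2\beta)^2\quad\text{for some }(a,b)\in\mathbb{F}\times\mathbb{F}\setminus\{(0,0)\}.$$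 -/

import Mathlib

/-- A symplectic alternating algebra over `F` with underlying vector space `L`: a non-degenerate
alternating form together with an alternating bilinear product such that
`(x · y, z) = (y · z, x)`. -/
structure SymplecticAlternatingAlgebra (F L : Type*) [Field F] [AddCommGroup L] [Module F L] where
  /-- the alternating form `(x, y)` -/
  form : LinearMap.BilinForm F L
  /-- the product `x · y` -/
  mul : L →ₗ[F] L →ₗ[F] L
  form_self : ∀ x, form x x = 0
  form_nondegenerate : form.Nondegenerate
  mul_self : ∀ x, mul x x = 0
  form_mul : ∀ x y z, form (mul x y) z = form (mul y z) x

namespace SymplecticAlternatingAlgebra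

variable {F L L' : Type*} [Field F] [AddCommGroup L] [Module F L] [AddCommGroup L'] [Module F L']

/-- The powers `L¹ = L`, `Lⁿ⁺¹ = Lⁿ L` (the linear span of all products `u · v` with `u ∈ Lⁿ` and
`v ∈ L`). The value at `0` is a convention that plays no role. -/
def power (A : SymplecticAlternatingAlgebra F L) : ℕ → Submodule F L
  | 0 => ⊤
  | 1 => ⊤
  | n + 2 => Submodule.map₂ A.mul (A.power (n + 1)) ⊤

/-- `L` is nilpotent if `Lⁿ = 0` for some `n`. -/
def IsNilpotentAlgebra (A : SymplecticAlternatingAlgebra F L) : Prop :=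
  ∃ n, A.power n = ⊥

/-- The centre `Z(L) = {z | z · u = 0 for all u}`. -/
def center (A : SymplecticAlternatingAlgebra F L) : Submodule F L :=
  LinearMap.ker A.mul

theorem form_swap (A : SymplecticAlternatingAlgebra F L) (x y : L) :
    A.form x y = -A.form y x := by
  have h := A.form_self (x + y)
  simp only [map_add, LinearMap.add_apply, A.form_self, zero_add, add_zero] at h
  exact eq_neg_of_add_eq_zero_right h

theorem mul_swap (A : SymplecticAlternatingAlgebra F L) (x y : L) :
    A.mul x y = -A.mul y x := by
  have h := A.mul_self (x + y)
  simp only [map_add, LinearMap.add_apply, A.mul_self, zero_add, add_zero] at h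
  exact eq_neg_of_add_eq_zero_right h

theorem form_center_square (A : SymplecticAlternatingAlgebra F L) {w z : L} (hw : w ∈ A.center)
    (hz : z ∈ A.power 2) : A.form w z = 0 := by
  have hle : A.power 2 ≤ LinearMap.ker (A.form w) := by
    change Submodule.map₂ A.mul (A.power 1) ⊤ ≤ _
    rw [Submodule.map₂_le]
    intro a _ b _
    have hw' : A.mul w = 0 := hw
    rw [LinearMap.mem_ker, A.form_swap, A.form_mul, A.mul_swap, hw']
    simp
  exact hle hz

/-- If `L³ ≤ Z(L)` then `(z · u, v) = 0` for `z, u ∈ L²`. -/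
theorem triple_eq_zero (A : SymplecticAlternatingAlgebra F L) (h : A.power 3 ≤ A.center) {z u : L}
    (hz : z ∈ A.power 2) (hu : u ∈ A.power 2) (v : L) : A.form (A.mul z u) v = 0 := by
  rw [A.form_mul]
  exact A.form_center_square (h (Submodule.apply_mem_map₂ A.mul hu Submodule.mem_top)) hz

theorem triple_eq_zero' (A : SymplecticAlternatingAlgebra F L) (h : A.power 3 ≤ A.center) {z v : L}
    (hz : z ∈ A.power 2) (u : L) (hv : v ∈ A.power 2) : A.form (A.mul z u) v = 0 := by
  rw [A.form_mul, A.form_mul, A.mul_swap, map_neg, LinearMap.neg_apply,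
    A.triple_eq_zero h hz hv, neg_zero]

/-- The form `φ_z : L/L² × L/L² → F`, `φ_z(u + L², v + L²) = (z · u, v)`, for `z ∈ L²`. It is well
defined when `L³ ≤ Z(L)`, and it depends only on the class of `z` in `L²/Z(L)`. -/
def phi (A : SymplecticAlternatingAlgebra F L) (h : A.power 3 ≤ A.center) (z : A.power 2) :
    LinearMap.BilinForm F (L ⧸ A.power 2) :=
  (A.form.comp (A.mul z) LinearMap.id).liftQ₂ (A.power 2) (A.power 2)
    (fun _ hu => LinearMap.ext fun v => A.triple_eq_zero h z.2 hu v)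
    (fun _ hv => LinearMap.ext fun u => A.triple_eq_zero' h z.2 u hv)

theorem phi_mk (A : SymplecticAlternatingAlgebra F L) (h : A.power 3 ≤ A.center) (z : A.power 2)
    (u v : L) :
    A.phi h z (Submodule.Quotient.mk u) (Submodule.Quotient.mk v) = A.form (A.mul z u) v :=
  rfl

/-- `L` is a nilpotent symplectic alternating algebra of dimension `10` with an isotropic centre of
dimension `4`, with `L³ = Z(L)`, and of type C: the form `φ_z` is non-degenerate for every
`z ∈ L²` whose class in `L²/Z(L)` is non-zero. -/
structure IsTypeC (A : SymplecticAlternatingAlgebra F L) : Prop where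
  nilpotent : A.IsNilpotentAlgebra
  finrank_eq : Module.finrank F L = 10
  center_isotropic : ∀ u ∈ A.center, ∀ v ∈ A.center, A.form u v = 0
  finrank_center : Module.finrank F A.center = 4
  cube_eq_center : A.power 3 = A.center
  phi_nondegenerate : ∀ z : A.power 2, (z : L) ∉ A.center →
    (A.phi cube_eq_center.le z).Nondegenerate

/-- A standard basis `x₁, …, xₙ, y₁, …, yₙ`: `(xᵢ, xⱼ) = (yᵢ, yⱼ) = 0` and `(xᵢ, yⱼ) = δᵢⱼ`. Here
`xᵢ₊₁ = b (inl i)` and `yᵢ₊₁ = b (inr i)` for `i : Fin n`. -/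
structure IsStandardBasis (A : SymplecticAlternatingAlgebra F L) {n : ℕ}
    (b : Module.Basis (Fin n ⊕ Fin n) F L) : Prop where
  form_x_x : ∀ i j, A.form (b (.inl i)) (b (.inl j)) = 0
  form_y_y : ∀ i j, A.form (b (.inr i)) (b (.inr j)) = 0
  form_x_y : ∀ i j, A.form (b (.inl i)) (b (.inr j)) = if i = j then 1 else 0

/-- `A` has, with respect to the standard basis `b`, the nilpotent presentation
`(xᵢ yⱼ, yₖ) = p i j k`, `(yᵢ yⱼ, yₖ) = q i j k` for `i < j < k`. The triple values
`(xᵢ xⱼ, w)` and `(xᵢ yⱼ, w)` with `j ≤ i` vanish; the remaining triple values on basis vectors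
are determined by these, since `(u v, w)` is alternating in `u, v, w`. Only the values of `p`
and `q` at `i < j < k` matter. -/
structure HasNilpotentPresentation (A : SymplecticAlternatingAlgebra F L) {n : ℕ}
    (b : Module.Basis (Fin n ⊕ Fin n) F L) (p q : Fin n → Fin n → Fin n → F) : Prop where
  standard : A.IsStandardBasis b
  mul_x_x : ∀ i j, A.mul (b (.inl i)) (b (.inl j)) = 0
  mul_x_y : ∀ i j, j ≤ i → A.mul (b (.inl i)) (b (.inr j)) = 0
  triple_x_y_y : ∀ i j k, i < j → j < k →
    A.form (A.mul (b (.inl i)) (b (.inr j))) (b (.inr k)) = p i j k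
  triple_y_y_y : ∀ i j k, i < j → j < k →
    A.form (A.mul (b (.inr i)) (b (.inr j))) (b (.inr k)) = q i j k

/-- `A` has the presentation
`P(β) : (x₁y₂, y₃) = 1, (x₁y₄, y₅) = β, (y₁y₂, y₅) = 1, (y₁y₃, y₄) = 1`
with respect to some standard basis, the values `(xᵢyⱼ, yₖ)` and `(yᵢyⱼ, yₖ)`, `i < j < k`, that
are not listed being `0` (the indices below start at `0`). -/
def HasPresentation (A : SymplecticAlternatingAlgebra F L) (β : F) : Prop :=
  ∃ b : Module.Basis (Fin 5 ⊕ Fin 5) F L,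
    A.HasNilpotentPresentation b
      (fun i j k => if (i, j, k) = (0, 1, 2) then 1 else if (i, j, k) = (0, 3, 4) then β else 0)
      (fun i j k => if (i, j, k) = (0, 1, 4) ∨ (i, j, k) = (0, 2, 3) then 1 else 0)

/-- Isomorphism of symplectic alternating algebras: a linear bijection that preserves the form and
the product. -/
def IsIsomorphic (A : SymplecticAlternatingAlgebra F L) (A' : SymplecticAlternatingAlgebra F L') :
    Prop :=
  ∃ e : L ≃ₗ[F] L', (∀ u v, A'.form (e u) (e v) = A.form u v) ∧
    ∀ u v, e (A.mul u v) = A'.mul (e u) (e v)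

end SymplecticAlternatingAlgebra

namespace SymplecticAlternatingAlgebra

variable {F L L' : Type*} [Field F] [AddCommGroup L] [Module F L] [AddCommGroup L'] [Module F L']

/-! ### General facts -/

/-! The centre is the orthogonal complement of `L²`, so `L²` has dimension 6, `L²/Z(L)` is a
symplectic plane and `L/L²` has dimension 4. The invariant behind everything is the pencil `z ↦ φ_z`
of alternating forms on `L/L²`, parametrised by that plane. Its Pfaffian is a binary quadratic form,
equal up to sign to `βa² + b²` at `ax₁ + by₁` in `P(β)`. Type C says that this form is anisotropic,
that is, `β ∉ -F²`.

Existence of a presentation: take `x, y ∈ L²` with `(x, y) = 1` and let `T = φ_y⁻¹φ_x`. It is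
self-adjoint for `φ_y`, and replacing `x` by `x - (s/2)y` makes its trace vanish, so that `T² = -β`;
vectors `v, w` and their images under `T` then give the required matrices
(`exists_hasPresentation`). Adding multiples of `y` to lifts of these vectors kills the remaining
triple values (`hasPresentation_of_vectors`).

A presentation fixes all triple values, so every algebra with presentation `P(β)` is isomorphic to
`model β`, and the other claims can be checked there.

Classification: an isomorphism has determinant 1 on the planes and multiplies Pfaffians by a
determinant `δ`. Comparing discriminants gives `β' = βD²`, where `D = δ⁻¹` is a value of the second
quadratic form; this value can be rewritten as `a² + b²β` (`exists_of_model_isIsomorphic`).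
Conversely, a determinant 1 change of `x₁, y₁` realises each such `D`
(`model_hasPresentation_mul_sq`). -/

theorem form_mul_swap (A : SymplecticAlternatingAlgebra F L) (x y z : L) :
    A.form (A.mul x y) z = -A.form (A.mul y x) z := by
  rw [A.mul_swap, map_neg, LinearMap.neg_apply]

theorem form_mul_swap_right (A : SymplecticAlternatingAlgebra F L) (x y z : L) :
    A.form (A.mul x y) z = -A.form (A.mul x z) y := by
  rw [A.form_mul, A.form_mul, A.form_mul_swap]

theorem form_mul_self_left (A : SymplecticAlternatingAlgebra F L) (x y : L) :
    A.form (A.mul x y) x = 0 := by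
  rw [A.form_mul, A.form_mul, A.mul_self]; simp

theorem form_mul_self_right (A : SymplecticAlternatingAlgebra F L) (x y : L) :
    A.form (A.mul x y) y = 0 := by
  rw [A.form_mul, A.mul_self]; simp

theorem eq_of_form_eq (A : SymplecticAlternatingAlgebra F L) {u v : L}
    (h : ∀ w, A.form u w = A.form v w) : u = v := by
  rw [← sub_eq_zero]
  refine A.form_nondegenerate.1 _ fun w => ?_
  rw [map_sub, LinearMap.sub_apply, h, sub_self]

theorem mul_mem_power_succ (A : SymplecticAlternatingAlgebra F L) {n : ℕ} {u : L}
    (hu : u ∈ A.power (n + 1)) (v : L) : A.mul u v ∈ A.power (n + 2) :=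
  Submodule.apply_mem_map₂ A.mul hu Submodule.mem_top

theorem mul_mem_power_two (A : SymplecticAlternatingAlgebra F L) (u v : L) :
    A.mul u v ∈ A.power 2 :=
  A.mul_mem_power_succ (n := 0) Submodule.mem_top v

theorem power_three_le_power_two (A : SymplecticAlternatingAlgebra F L) :
    A.power 3 ≤ A.power 2 :=
  Submodule.map₂_le.2 fun u _ v _ => A.mul_mem_power_two u v

theorem mul_center_left (A : SymplecticAlternatingAlgebra F L) {z : L} (hz : z ∈ A.center)
    (u : L) : A.mul z u = 0 := by
  have h : A.mul z = 0 := hz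
  rw [h, LinearMap.zero_apply]

theorem mul_center_right (A : SymplecticAlternatingAlgebra F L) {z : L} (hz : z ∈ A.center)
    (u : L) : A.mul u z = 0 := by
  rw [A.mul_swap, A.mul_center_left hz, neg_zero]

/-- Since `(wa, b) = (ab, w)`, the centre is the orthogonal complement of `L²`. -/
theorem mem_center_iff_forall_form (A : SymplecticAlternatingAlgebra F L) {w : L} :
    w ∈ A.center ↔ ∀ z ∈ A.power 2, A.form w z = 0 := by
  refine ⟨fun hw z hz => A.form_center_square hw hz, fun h => ?_⟩
  refine LinearMap.ext fun a => A.eq_of_form_eq fun b => ?_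
  rw [A.form_mul, A.form_swap, h _ (A.mul_mem_power_two a b)]
  simp

/-- Triple values live on `L/Z(L)`; this leaves freedom to adjust vectors by central ones to reach a
standard basis. -/
theorem form_mul_sub_center (A : SymplecticAlternatingAlgebra F L) {u v w u' v' w' : L}
    (hu : u' - u ∈ A.center) (hv : v' - v ∈ A.center) (hw : w' - w ∈ A.center) :
    A.form (A.mul u' v') w' = A.form (A.mul u v) w := by
  have h1 : A.mul u' v' = A.mul u v := by
    have e1 := A.mul_center_left hu v'
    have e2 := A.mul_center_right hv u
    rw [map_sub, LinearMap.sub_apply, sub_eq_zero] at e1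
    rw [map_sub, sub_eq_zero] at e2
    rw [e1, e2]
  have e3 := A.form_center_square hw (A.mul_mem_power_two u v)
  rw [A.form_swap, neg_eq_zero, map_sub, sub_eq_zero] at e3
  rw [h1, e3]

/-- Removes the quotient: `φ_z` is alternating, so one-sided separation suffices, and its radical is
the annihilator of `z` modulo `L²`. -/
theorem phi_nondegenerate_iff (A : SymplecticAlternatingAlgebra F L) (h : A.power 3 ≤ A.center)
    (z : A.power 2) :
    (A.phi h z).Nondegenerate ↔ ∀ u, A.mul z u = 0 → u ∈ A.power 2 := by
  have halt : (A.phi h z).IsAlt := by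
    intro u
    induction u using Submodule.Quotient.induction_on with
    | H u => rw [A.phi_mk]; exact A.form_mul_self_right _ _
  rw [LinearMap.BilinForm.Nondegenerate,
    LinearMap.IsRefl.nondegenerate_iff_separatingLeft halt.isRefl]
  constructor
  · intro hs u hu
    rw [← Submodule.Quotient.mk_eq_zero]
    refine hs _ fun v => ?_
    induction v using Submodule.Quotient.induction_on with
    | H v => rw [A.phi_mk, hu]; simp
  · intro hs u hu
    induction u using Submodule.Quotient.induction_on with
    | H u =>
      rw [Submodule.Quotient.mk_eq_zero]
      refine hs u (A.eq_of_form_eq fun v => ?_)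
      rw [← A.phi_mk h, hu]; simp

/-! ### Isomorphisms -/

namespace IsIsomorphic

variable {A : SymplecticAlternatingAlgebra F L} {A' : SymplecticAlternatingAlgebra F L'}

theorem trans {L'' : Type*} [AddCommGroup L''] [Module F L'']
    {A'' : SymplecticAlternatingAlgebra F L''} (h : A.IsIsomorphic A')
    (h' : A'.IsIsomorphic A'') : A.IsIsomorphic A'' := by
  obtain ⟨e, h1, h2⟩ := h
  obtain ⟨e', h1', h2'⟩ := h'
  refine ⟨e.trans e', fun u v => ?_, fun u v => ?_⟩
  · simp [h1, h1']
  · simp [h2, h2']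

end IsIsomorphic

section Transport

variable {A : SymplecticAlternatingAlgebra F L} {A' : SymplecticAlternatingAlgebra F L'}
  {e : L ≃ₗ[F] L'}

theorem map_power_eq (he : ∀ u v, e (A.mul u v) = A'.mul (e u) (e v)) :
    ∀ n, (A.power n).map (e : L →ₗ[F] L') = A'.power n
  | 0 => by simp [power]
  | 1 => by simp [power]
  | n + 2 => by
    have ih := map_power_eq he (n + 1)
    change (Submodule.map₂ A.mul (A.power (n + 1)) ⊤).map _ =
      Submodule.map₂ A'.mul (A'.power (n + 1)) ⊤
    have htop : (⊤ : Submodule F L').map (e.symm : L' →ₗ[F] L) = ⊤ := by simp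
    have htop' : (⊤ : Submodule F L).map (e : L →ₗ[F] L') = ⊤ := by simp
    rw [Submodule.map_map₂, ← ih, ← htop', Submodule.map₂_map_map]
    congr 1
    ext u v
    simp [he]

theorem map_center_eq (he : ∀ u v, e (A.mul u v) = A'.mul (e u) (e v)) :
    A.center.map (e : L →ₗ[F] L') = A'.center := by
  ext z
  rw [Submodule.mem_map_equiv]
  constructor
  · intro h
    refine LinearMap.ext fun u => ?_
    have := he (e.symm z) (e.symm u)
    rw [A.mul_center_left h] at this
    simpa using this.symm
  · intro h
    refine LinearMap.ext fun u => e.injective ?_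
    rw [he, e.apply_symm_apply, A'.mul_center_left h]
    simp

theorem apply_mem_power_iff (he : ∀ u v, e (A.mul u v) = A'.mul (e u) (e v)) {n : ℕ} {u : L} :
    e u ∈ A'.power n ↔ u ∈ A.power n := by
  rw [← map_power_eq he, Submodule.mem_map_equiv, e.symm_apply_apply]

theorem apply_mem_center_iff (he : ∀ u v, e (A.mul u v) = A'.mul (e u) (e v)) {u : L} :
    e u ∈ A'.center ↔ u ∈ A.center := by
  rw [← map_center_eq he, Submodule.mem_map_equiv, e.symm_apply_apply]

end Transport

theorem IsTypeC.of_isIsomorphic {A : SymplecticAlternatingAlgebra F L}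
    {A' : SymplecticAlternatingAlgebra F L'} (h : A.IsIsomorphic A') (hA' : A'.IsTypeC) :
    A.IsTypeC := by
  obtain ⟨e, hf, he⟩ := h
  have hcube : A.power 3 = A.center := by
    ext u
    rw [← apply_mem_power_iff he, ← apply_mem_center_iff he, hA'.cube_eq_center]
  refine ⟨?_, ?_, ?_, ?_, hcube, ?_⟩
  · obtain ⟨n, hn⟩ := hA'.nilpotent
    refine ⟨n, (Submodule.eq_bot_iff _).2 fun u hu => ?_⟩
    rw [← apply_mem_power_iff he, hn, Submodule.mem_bot] at hu
    simpa using hu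
  · rw [e.finrank_eq, hA'.finrank_eq]
  · intro u hu v hv
    rw [← hf]
    exact hA'.center_isotropic _ ((apply_mem_center_iff he).2 hu) _
      ((apply_mem_center_iff he).2 hv)
  · rw [← hA'.finrank_center, ← map_center_eq he]
    exact (e.finrank_map_eq _).symm
  · intro z hz
    rw [phi_nondegenerate_iff]
    intro u hu
    have := hA'.phi_nondegenerate ⟨e z, (apply_mem_power_iff he).2 z.2⟩
      fun h => hz ((apply_mem_center_iff he).1 h)
    rw [phi_nondegenerate_iff] at this
    refine (apply_mem_power_iff he).1 (this _ ?_)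
    change A'.mul (e z) (e u) = 0
    rw [← he, hu, map_zero]

/-! ### Presentations determine the algebra -/

/-- The triple value is alternating in its three arguments, so sorting the indices reduces each case
to a listed or a vanishing value. -/
theorem HasNilpotentPresentation.form_mul_eq {n : ℕ} {p q : Fin n → Fin n → Fin n → F}
    {A : SymplecticAlternatingAlgebra F L} {A' : SymplecticAlternatingAlgebra F L'}
    {b : Module.Basis (Fin n ⊕ Fin n) F L} {b' : Module.Basis (Fin n ⊕ Fin n) F L'}
    (h : A.HasNilpotentPresentation b p q) (h' : A'.HasNilpotentPresentation b' p q)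
    (i j k : Fin n ⊕ Fin n) :
    A.form (A.mul (b i) (b j)) (b k) = A'.form (A'.mul (b' i) (b' j)) (b' k) := by
  have xx : ∀ i j k, A.form (A.mul (b (.inl i)) (b (.inl j))) (b k) =
      A'.form (A'.mul (b' (.inl i)) (b' (.inl j))) (b' k) := by
    intro i j k
    simp [h.mul_x_x, h'.mul_x_x]
  have xyy : ∀ i j k, A.form (A.mul (b (.inl i)) (b (.inr j))) (b (.inr k)) =
      A'.form (A'.mul (b' (.inl i)) (b' (.inr j))) (b' (.inr k)) := by
    intro i j k
    rcases le_or_gt j i with hj | hj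
    · simp [h.mul_x_y _ _ hj, h'.mul_x_y _ _ hj]
    rcases le_or_gt k i with hk | hk
    · rw [A.form_mul_swap_right, A'.form_mul_swap_right]
      simp [h.mul_x_y _ _ hk, h'.mul_x_y _ _ hk]
    rcases lt_trichotomy j k with hjk | rfl | hjk
    · rw [h.triple_x_y_y _ _ _ hj hjk, h'.triple_x_y_y _ _ _ hj hjk]
    · rw [A.form_mul_self_right, A'.form_mul_self_right]
    · rw [A.form_mul_swap_right, A'.form_mul_swap_right, h.triple_x_y_y _ _ _ hk hjk,
        h'.triple_x_y_y _ _ _ hk hjk]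
  have yyy : ∀ i j k, A.form (A.mul (b (.inr i)) (b (.inr j))) (b (.inr k)) =
      A'.form (A'.mul (b' (.inr i)) (b' (.inr j))) (b' (.inr k)) := by
    have key : ∀ i j k, i < j → A.form (A.mul (b (.inr i)) (b (.inr j))) (b (.inr k)) =
      A'.form (A'.mul (b' (.inr i)) (b' (.inr j))) (b' (.inr k)) := by
      intro i j k hij
      rcases lt_trichotomy j k with hjk | rfl | hjk
      · rw [h.triple_y_y_y _ _ _ hij hjk, h'.triple_y_y_y _ _ _ hij hjk]
      · rw [A.form_mul_self_right, A'.form_mul_self_right]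
      rcases lt_trichotomy i k with hik | rfl | hik
      · rw [A.form_mul_swap_right, A'.form_mul_swap_right, h.triple_y_y_y _ _ _ hik hjk,
          h'.triple_y_y_y _ _ _ hik hjk]
      · rw [A.form_mul_self_left, A'.form_mul_self_left]
      · rw [← A.form_mul, ← A'.form_mul, h.triple_y_y_y _ _ _ hik hij,
          h'.triple_y_y_y _ _ _ hik hij]
    intro i j k
    rcases lt_trichotomy i j with hij | rfl | hij
    · exact key _ _ _ hij
    · simp [A.mul_self, A'.mul_self]
    · rw [A.form_mul_swap, A'.form_mul_swap, key _ _ _ hij]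
  rcases i with i | i <;> rcases j with j | j
  · exact xx i j k
  · rcases k with k | k
    · rw [← A.form_mul, ← A'.form_mul, xx]
    · exact xyy i j k
  · rcases k with k | k
    · rw [A.form_mul, A'.form_mul, xx]
    · rw [A.form_mul_swap, A'.form_mul_swap, xyy]
  · rcases k with k | k
    · rw [← A.form_mul, ← A'.form_mul, xyy]
    · exact yyy i j k

theorem IsStandardBasis.form_eq {n : ℕ} {A : SymplecticAlternatingAlgebra F L}
    {A' : SymplecticAlternatingAlgebra F L'} {b : Module.Basis (Fin n ⊕ Fin n) F L}
    {b' : Module.Basis (Fin n ⊕ Fin n) F L'} (h : A.IsStandardBasis b)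
    (h' : A'.IsStandardBasis b') (i j : Fin n ⊕ Fin n) :
    A.form (b i) (b j) = A'.form (b' i) (b' j) := by
  rcases i with i | i <;> rcases j with j | j
  · rw [h.form_x_x, h'.form_x_x]
  · rw [h.form_x_y, h'.form_x_y]
  · rw [A.form_swap, A'.form_swap, h.form_x_y, h'.form_x_y]
  · rw [h.form_y_y, h'.form_y_y]

theorem HasNilpotentPresentation.isIsomorphic {n : ℕ} {p q : Fin n → Fin n → Fin n → F}
    {A : SymplecticAlternatingAlgebra F L} {A' : SymplecticAlternatingAlgebra F L'}
    {b : Module.Basis (Fin n ⊕ Fin n) F L} {b' : Module.Basis (Fin n ⊕ Fin n) F L'}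
    (h : A.HasNilpotentPresentation b p q) (h' : A'.HasNilpotentPresentation b' p q) :
    A.IsIsomorphic A' := by
  let e : L ≃ₗ[F] L' := b.equiv b' (Equiv.refl _)
  have eb : ∀ i, e (b i) = b' i := fun i => by simp [e]
  have hf : A'.form.compl₁₂ (e : L →ₗ[F] L') (e : L →ₗ[F] L') = A.form :=
    b.ext fun i => b.ext fun j => by
      simp [eb, h.standard.form_eq h'.standard]
  have hf' : ∀ u v, A'.form (e u) (e v) = A.form u v := fun u v => by
    rw [← hf]; rfl
  have hm : A.mul.compr₂ (e : L →ₗ[F] L') =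
      A'.mul.compl₁₂ (e : L →ₗ[F] L') (e : L →ₗ[F] L') := by
    -- By non-degeneracy, products agree once the triple values do.
    refine b.ext fun i => b.ext fun j => A'.eq_of_form_eq fun w => ?_
    have : A'.form (e (A.mul (b i) (b j))) = A'.form (A'.mul (e (b i)) (e (b j))) :=
      b'.ext fun k => by
        rw [← eb k, hf', eb, eb, eb, h.form_mul_eq h']
    exact LinearMap.congr_fun this w
  exact ⟨e, hf', fun u v => LinearMap.congr_fun₂ hm u v⟩

theorem HasPresentation.isIsomorphic {β : F} {A : SymplecticAlternatingAlgebra F L}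
    {A' : SymplecticAlternatingAlgebra F L'} (h : A.HasPresentation β)
    (h' : A'.HasPresentation β) : A.IsIsomorphic A' := by
  obtain ⟨b, hb⟩ := h
  obtain ⟨b', hb'⟩ := h'
  exact hb.isIsomorphic hb'

/-! ### The model of the presentation `P(β)` -/

/-- The product of the coordinate model of `P(β)`. -/
def modelProd (β : F) (u v : Fin 5 ⊕ Fin 5 → F) : Fin 5 ⊕ Fin 5 → F :=
  Sum.elim
    ![(u (.inr 1) * v (.inr 4) - v (.inr 1) * u (.inr 4)) +
        (u (.inr 2) * v (.inr 3) - v (.inr 2) * u (.inr 3)),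
      (u (.inr 2) * v (.inl 0) - v (.inr 2) * u (.inl 0)) +
        (u (.inr 4) * v (.inr 0) - v (.inr 4) * u (.inr 0)),
      (u (.inl 0) * v (.inr 1) - v (.inl 0) * u (.inr 1)) +
        (u (.inr 3) * v (.inr 0) - v (.inr 3) * u (.inr 0)),
      β * (u (.inr 4) * v (.inl 0) - v (.inr 4) * u (.inl 0)) +
        (u (.inr 0) * v (.inr 2) - v (.inr 0) * u (.inr 2)),
      β * (u (.inl 0) * v (.inr 3) - v (.inl 0) * u (.inr 3)) +
        (u (.inr 0) * v (.inr 1) - v (.inr 0) * u (.inr 1))]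
    ![-((u (.inr 1) * v (.inr 2) - v (.inr 1) * u (.inr 2)) +
        β * (u (.inr 3) * v (.inr 4) - v (.inr 3) * u (.inr 4))), 0, 0, 0, 0]

/-- The coordinate model of the presentation `P(β)`. -/
def model (β : F) : SymplecticAlternatingAlgebra F (Fin 5 ⊕ Fin 5 → F) where
  form := LinearMap.mk₂ F
    (fun u v => ∑ i, (u (.inl i) * v (.inr i) - u (.inr i) * v (.inl i)))
    (fun u u' v => by
      rw [← Finset.sum_add_distrib]
      exact Finset.sum_congr rfl fun i _ => by simp only [Pi.add_apply]; ring)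
    (fun c u v => by
      rw [smul_eq_mul, Finset.mul_sum]
      exact Finset.sum_congr rfl fun i _ => by simp only [Pi.smul_apply, smul_eq_mul]; ring)
    (fun u v v' => by
      rw [← Finset.sum_add_distrib]
      exact Finset.sum_congr rfl fun i _ => by simp only [Pi.add_apply]; ring)
    (fun c u v => by
      rw [smul_eq_mul, Finset.mul_sum]
      exact Finset.sum_congr rfl fun i _ => by simp only [Pi.smul_apply, smul_eq_mul]; ring)
  mul := LinearMap.mk₂ F (modelProd β)
    (fun u u' v => by
      ext (i | i) <;> fin_cases i <;> simp [modelProd] <;> ring)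
    (fun c u v => by
      ext (i | i) <;> fin_cases i <;> simp [modelProd] <;> ring)
    (fun u v v' => by
      ext (i | i) <;> fin_cases i <;> simp [modelProd] <;> ring)
    (fun c u v => by
      ext (i | i) <;> fin_cases i <;> simp [modelProd] <;> ring)
  form_self u := by
    simp only [LinearMap.mk₂_apply]
    exact Finset.sum_eq_zero fun i _ => by ring
  form_nondegenerate := by
    constructor
    · intro u hu
      ext (i | i)
      · simpa [Pi.single_apply] using hu (Pi.single (.inr i) 1)
      · simpa [Pi.single_apply] using hu (Pi.single (.inl i) 1)
    · intro u hu
      ext (i | i)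
      · simpa [Pi.single_apply] using hu (Pi.single (.inr i) 1)
      · simpa [Pi.single_apply] using hu (Pi.single (.inl i) 1)
  mul_self u := by
    rw [LinearMap.mk₂_apply]
    ext (i | i) <;> fin_cases i <;> simp [modelProd]
  form_mul u v w := by
    simp only [LinearMap.mk₂_apply, Fin.sum_univ_five]
    simp [modelProd]
    ring

theorem model_form_apply (β : F) (u v : Fin 5 ⊕ Fin 5 → F) :
    (model β).form u v = ∑ i, (u (.inl i) * v (.inr i) - u (.inr i) * v (.inl i)) := rfl

theorem model_mul_apply (β : F) (u v : Fin 5 ⊕ Fin 5 → F) :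
    (model β).mul u v = modelProd β u v := rfl

theorem model_hasPresentation (β : F) : (model β).HasPresentation β := by
  refine ⟨Pi.basisFun F _, ⟨⟨?_, ?_, ?_⟩, ?_, ?_, ?_, ?_⟩⟩
  · intro i j
    simp [model_form_apply]
  · intro i j
    simp [model_form_apply]
  · intro i j
    simp [model_form_apply, Pi.single_apply, eq_comm]
  · intro i j
    rw [model_mul_apply]
    ext (k | k) <;> fin_cases k <;> simp [modelProd]
  · intro i j hij
    rw [model_mul_apply]
    ext (k | k) <;> fin_cases i <;> fin_cases j <;> fin_cases k <;>
      first | (exfalso; revert hij; decide) | simp [modelProd]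
  · intro i j k hij hjk
    rw [model_mul_apply, model_form_apply, Fin.sum_univ_five]
    fin_cases i <;> fin_cases j <;>
      first | (exfalso; revert hij; decide) | skip
    all_goals fin_cases k <;>
      first | (exfalso; revert hjk; decide) | simp [modelProd]
  · intro i j k hij hjk
    rw [model_mul_apply, model_form_apply, Fin.sum_univ_five]
    fin_cases i <;> fin_cases j <;>
      first | (exfalso; revert hij; decide) | skip
    all_goals fin_cases k <;>
      first | (exfalso; revert hjk; decide) | simp [modelProd]

theorem model_mem_power_two_iff (β : F) {u : Fin 5 ⊕ Fin 5 → F} :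
    u ∈ (model β).power 2 ↔ ∀ i : Fin 4, u (.inr i.succ) = 0 := by
  constructor
  · intro hu i
    have hle : (model β).power 2 ≤ LinearMap.ker
        (LinearMap.proj (R := F) (φ := fun _ => F) (Sum.inr i.succ : Fin 5 ⊕ Fin 5)) := by
      refine Submodule.map₂_le.2 fun u _ v _ => ?_
      rw [LinearMap.mem_ker, LinearMap.proj_apply, model_mul_apply]
      fin_cases i <;> simp [modelProd]
    exact hle hu
  · intro hu
    let y : Fin 5 → Fin 5 ⊕ Fin 5 → F := fun i => Pi.single (.inr i) 1
    have e : u = u (.inl 0) • (model β).mul (y 1) (y 4) +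
        (-u (.inr 0)) • (model β).mul (y 1) (y 2) + u (.inl 1) • (model β).mul (y 4) (y 0) +
        u (.inl 2) • (model β).mul (y 3) (y 0) + u (.inl 3) • (model β).mul (y 0) (y 2) +
        u (.inl 4) • (model β).mul (y 0) (y 1) := by
      have h1 := hu 0
      have h2 := hu 1
      have h3 := hu 2
      have h4 := hu 3
      simp only [Fin.isValue, Fin.succ_zero_eq_one, Fin.reduceSucc] at h1 h2 h3 h4
      simp only [model_mul_apply, y]
      ext (i | i) <;> fin_cases i <;> simp [modelProd, h1, h2, h3, h4]
    rw [e]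
    have hm := (model β).mul_mem_power_two
    exact add_mem (add_mem (add_mem (add_mem (add_mem (Submodule.smul_mem _ _ (hm _ _))
      (Submodule.smul_mem _ _ (hm _ _))) (Submodule.smul_mem _ _ (hm _ _)))
      (Submodule.smul_mem _ _ (hm _ _))) (Submodule.smul_mem _ _ (hm _ _)))
      (Submodule.smul_mem _ _ (hm _ _))

theorem model_mem_center_iff (β : F) {u : Fin 5 ⊕ Fin 5 → F} :
    u ∈ (model β).center ↔ u (.inl 0) = 0 ∧ ∀ i, u (.inr i) = 0 := by
  constructor
  · intro hu
    have h1 := congr_fun ((model β).mul_center_left hu (Pi.single (.inr 1) 1))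
    have h2 := congr_fun ((model β).mul_center_left hu (Pi.single (.inr 2) 1))
    have h4 := congr_fun ((model β).mul_center_left hu (Pi.single (.inr 4) 1))
    simp only [model_mul_apply] at h1 h2 h4
    have e0 := h2 (.inl 1)
    have e1 := h4 (.inl 1)
    have e2 := h4 (.inl 0)
    have e3 := h1 (.inr 0)
    have e4 := h2 (.inl 0)
    have e5 := h1 (.inl 0)
    simp [modelProd] at e0 e1 e2 e3 e4 e5
    refine ⟨e0, fun i => ?_⟩
    fin_cases i <;> assumption
  · rintro ⟨h0, h⟩
    refine LinearMap.ext fun v => ?_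
    rw [model_mul_apply]
    ext (i | i) <;> fin_cases i <;> simp [modelProd, h0, h]

theorem model_mul_mem_center (β : F) {u : Fin 5 ⊕ Fin 5 → F} (hu : u ∈ (model β).power 2)
    (v : Fin 5 ⊕ Fin 5 → F) : (model β).mul u v ∈ (model β).center := by
  rw [model_mem_power_two_iff] at hu
  have h1 := hu 0
  have h2 := hu 1
  have h3 := hu 2
  have h4 := hu 3
  simp only [Fin.isValue, Fin.succ_zero_eq_one, Fin.reduceSucc] at h1 h2 h3 h4
  rw [model_mem_center_iff, model_mul_apply]
  refine ⟨by simp [modelProd, h1, h2, h3, h4], fun i => ?_⟩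
  fin_cases i <;> simp [modelProd, h1, h2, h3, h4]

theorem model_power_three (β : F) : (model β).power 3 = (model β).center := by
  refine le_antisymm (Submodule.map₂_le.2 fun u hu v _ => model_mul_mem_center β hu v) ?_
  intro u hu
  rw [model_mem_center_iff] at hu
  let y : Fin 5 → Fin 5 ⊕ Fin 5 → F := fun i => Pi.single (.inr i) 1
  -- As `y₁ ∈ L²`, the products of `y₁` with `y₂, …, y₅` lie in `L³`; up to sign they are `x₅, x₄,
  -- x₃, x₂`, which span the centre.
  have hy : y 0 ∈ (model β).power 2 := by
    rw [model_mem_power_two_iff]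
    intro i
    simp [y]
  have e : u = (-u (.inl 1)) • (model β).mul (y 0) (y 4) +
      (-u (.inl 2)) • (model β).mul (y 0) (y 3) + u (.inl 3) • (model β).mul (y 0) (y 2) +
      u (.inl 4) • (model β).mul (y 0) (y 1) := by
    obtain ⟨h0, h⟩ := hu
    simp only [model_mul_apply, y]
    ext (i | i) <;> fin_cases i <;> simp [modelProd, h0, h]
  rw [e]
  have hm := (model β).mul_mem_power_succ (n := 1) hy
  exact add_mem (add_mem (add_mem (Submodule.smul_mem _ _ (hm _))
    (Submodule.smul_mem _ _ (hm _))) (Submodule.smul_mem _ _ (hm _)))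
    (Submodule.smul_mem _ _ (hm _))

theorem model_finrank_center (β : F) : Module.finrank F (model β).center = 4 := by
  let f : (model β).center →ₗ[F] (Fin 4 → F) :=
    (LinearMap.funLeft F F fun i : Fin 4 => (Sum.inl i.succ : Fin 5 ⊕ Fin 5)).domRestrict _
  have hf : ∀ u i, f u i = (u : Fin 5 ⊕ Fin 5 → F) (.inl i.succ) := fun u i => rfl
  have hbij : Function.Bijective f := by
    constructor
    · rw [injective_iff_map_eq_zero]
      intro u hu
      obtain ⟨h0, h⟩ := (model_mem_center_iff β).1 u.2
      ext (i | i)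
      · refine Fin.cases h0 (fun i => ?_) i
        simpa [hf] using congr_fun hu i
      · exact h i
    · intro w
      refine ⟨⟨Sum.elim (Fin.cons 0 w) 0, ?_⟩, ?_⟩
      · rw [model_mem_center_iff]
        simp
      · ext i
        simp [hf]
  rw [(LinearEquiv.ofBijective f hbij).finrank_eq]
  simp

theorem add_sq_mul_ne_zero {β : F} (hβ : ∀ c : F, β ≠ -c ^ 2) {a b : F}
    (h : (a, b) ≠ (0, 0)) : a ^ 2 + b ^ 2 * β ≠ 0 := by
  intro h0
  rcases eq_or_ne b 0 with rfl | hb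
  · apply h
    simpa using h0
  · apply hβ (a / b)
    field_simp
    linear_combination h0

theorem model_isTypeC {β : F} (hβ : ∀ c : F, β ≠ -c ^ 2) : (model β).IsTypeC := by
  refine ⟨⟨4, ?_⟩, by simp, ?_, model_finrank_center β, model_power_three β, ?_⟩
  · rw [eq_bot_iff]
    refine Submodule.map₂_le.2 fun u hu v _ => ?_
    rw [Submodule.mem_bot]
    exact mul_center_left _ (model_power_three β ▸ hu) v
  · intro u hu v hv
    rw [model_mem_center_iff] at hu hv
    simp [model_form_apply, hu.2, hv.2]
  · rintro ⟨z, hz⟩ hzc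
    rw [phi_nondegenerate_iff]
    intro u hu
    rw [model_mem_power_two_iff] at hz ⊢
    have hne : (z (.inr 0), z (.inl 0)) ≠ (0, 0) := by
      intro h
      simp only [Prod.mk.injEq] at h
      exact hzc ((model_mem_center_iff β).2 ⟨h.2, Fin.cases h.1 hz⟩)
    have hN := add_sq_mul_ne_zero hβ hne
    have h1 := hz 0
    have h2 := hz 1
    have h3 := hz 2
    have h4 := hz 3
    simp only [Fin.isValue, Fin.succ_zero_eq_one, Fin.reduceSucc] at h1 h2 h3 h4
    simp only [model_mul_apply] at hu
    have e1 := congr_fun hu (.inl 1)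
    have e2 := congr_fun hu (.inl 2)
    have e3 := congr_fun hu (.inl 3)
    have e4 := congr_fun hu (.inl 4)
    simp [modelProd, h1, h2, h3, h4] at e1 e2 e3 e4
    intro i
    -- The equations split into two 2 × 2 systems, in the `y₂, y₄` and the `y₃, y₅` coordinates,
    -- each of determinant `a² + b²β` up to sign; Cramer's rule solves them.
    apply (mul_eq_zero_iff_left hN).1
    fin_cases i
    · change _ * u (.inr 1) = 0
      linear_combination z (.inl 0) * β * e2 + z (.inr 0) * e4
    · change _ * u (.inr 2) = 0
      linear_combination -z (.inl 0) * β * e1 + z (.inr 0) * e3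
    · change _ * u (.inr 3) = 0
      linear_combination -z (.inr 0) * e2 + z (.inl 0) * e4
    · change _ * u (.inr 4) = 0
      linear_combination -z (.inr 0) * e1 - z (.inl 0) * e3

/-! ### Construction of standard bases -/

theorem exists_basis_of_form (A : SymplecticAlternatingAlgebra F L) {n : ℕ} [NeZero n]
    (hdim : Module.finrank F L = 2 * n) {x y : Fin n → L}
    (hxx : ∀ i j, A.form (x i) (x j) = 0) (hyy : ∀ i j, A.form (y i) (y j) = 0)
    (hxy : ∀ i j, A.form (x i) (y j) = if i = j then 1 else 0) :
    ∃ b : Module.Basis (Fin n ⊕ Fin n) F L, A.IsStandardBasis b ∧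
      (∀ i, b (.inl i) = x i) ∧ ∀ i, b (.inr i) = y i := by
  have hyx : ∀ i j, A.form (y i) (x j) = if i = j then -1 else 0 := by
    intro i j
    rw [A.form_swap, hxy]
    simp only [eq_comm (a := j), apply_ite (Neg.neg : F → F), neg_zero]
  have hli : LinearIndependent F (Sum.elim x y) := by
    rw [Fintype.linearIndependent_iff]
    intro g hg
    have hx : ∀ j, g (.inl j) = 0 := by
      intro j
      have := congrArg (fun u => A.form u (y j)) hg
      simpa [hxy, hyy] using this
    have hy : ∀ j, g (.inr j) = 0 := by
      intro j
      have := congrArg (fun u => A.form u (x j)) hg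
      simpa [hyx, hxx] using this
    exact Sum.rec hx hy
  let b := basisOfLinearIndependentOfCardEqFinrank hli (by simp [hdim, two_mul])
  have hb : ⇑b = Sum.elim x y := coe_basisOfLinearIndependentOfCardEqFinrank _ _
  refine ⟨b, ⟨?_, ?_, ?_⟩, ?_, ?_⟩ <;> simp [hb, hxx, hyy, hxy]

/-- A hyperbolic pair in `L²` together with a family `u` and a dual family of central elements
can be changed modulo the centre into a standard basis. -/
theorem exists_standardBasis (A : SymplecticAlternatingAlgebra F L) {n : ℕ}
    (hdim : Module.finrank F L = 2 * (n + 1)) {x y : L} (hx : x ∈ A.power 2)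
    (hy : y ∈ A.power 2) (hxy : A.form x y = 1) {z u : Fin n → L}
    (hz : ∀ i, z i ∈ A.center) (hz2 : ∀ i, z i ∈ A.power 2)
    (hzu : ∀ i j, A.form (z i) (u j) = if i = j then 1 else 0) :
    ∃ b : Module.Basis (Fin (n + 1) ⊕ Fin (n + 1)) F L, A.IsStandardBasis b ∧
      b (.inl 0) - x ∈ A.center ∧ b (.inr 0) - y ∈ A.center ∧
      (∀ i, b (.inl (Fin.succ i)) ∈ A.center) ∧
      ∀ i, b (.inr (Fin.succ i)) - u i ∈ A.center := by
  -- `s` makes `x, y` orthogonal to the `u i`, and `c` makes the `u i` mutually orthogonal. Taking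
  -- `c` strictly triangular avoids halving.
  let s : L → L := fun w => w - ∑ i, A.form w (u i) • z i
  let c : Fin n → Fin n → F := fun i j => if i < j then -A.form (u i) (u j) else 0
  let v : Fin n → L := fun i => u i + ∑ j, c i j • z j
  have hsum : ∀ f : Fin n → F, ∑ i, f i • z i ∈ A.center := fun f =>
    sum_mem fun i _ => Submodule.smul_mem _ _ (hz i)
  have hzl : ∀ i, ∀ w ∈ A.power 2, A.form (z i) w = 0 := fun i w hw =>
    A.form_center_square (hz i) hw
  have hzr : ∀ i, ∀ w ∈ A.power 2, A.form w (z i) = 0 := fun i w hw => by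
    rw [A.form_swap, hzl i w hw, neg_zero]
  have huz : ∀ i j, A.form (u i) (z j) = if j = i then -1 else 0 := by
    intro i j
    rw [A.form_swap, hzu, apply_ite (Neg.neg : F → F), neg_zero]
  have hsv : ∀ w ∈ A.power 2, ∀ i, A.form (s w) (v i) = 0 := by
    intro w hw i
    simp [s, v, hzr _ w hw, hzl _ _ (hz2 _), hzu]
  have hzv : ∀ i j, A.form (z i) (v j) = if i = j then 1 else 0 := by
    intro i j
    simp [v, hzu, hzl _ _ (hz2 _)]
  have hvv : ∀ i j, A.form (v i) (v j) = 0 := by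
    intro i j
    have h1 : A.form (v i) (v j) = A.form (u i) (u j) + c i j - c j i := by
      simp [v, hzu, huz, hzl _ _ (hz2 _)]
      ring
    rw [h1]
    rcases lt_trichotomy i j with h | rfl | h
    · simp [c, h, h.not_gt]
    · simp [A.form_self]
    · simp [c, h, h.not_gt, A.form_swap (u i) (u j)]
  have hss : A.form (s x) (s y) = 1 := by
    simp [s, hzr _ x hx, hzl _ y hy, hzl _ _ (hz2 _), hxy]
  have hsz : ∀ w ∈ A.power 2, ∀ i, A.form (s w) (z i) = 0 := by
    intro w hw i
    simp [s, hzr _ w hw, hzl _ _ (hz2 _)]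
  have hzs : ∀ w ∈ A.power 2, ∀ i, A.form (z i) (s w) = 0 := by
    intro w hw i
    rw [A.form_swap, hsz w hw, neg_zero]
  obtain ⟨b, hb, hbx, hby⟩ := A.exists_basis_of_form (n := n + 1) hdim
    (x := Fin.cons (s x) z) (y := Fin.cons (s y) v)
    (by
      intro i j
      refine Fin.cases ?_ (fun i => ?_) i <;> refine Fin.cases ?_ (fun j => ?_) j <;>
        simp [A.form_self, hsz x hx, hzs x hx, hzl _ _ (hz2 _)])
    (by
      intro i j
      refine Fin.cases ?_ (fun i => ?_) i <;> refine Fin.cases ?_ (fun j => ?_) j <;>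
        simp [A.form_self, hsv y hy, hvv, A.form_swap (v _) (s y)])
    (by
      intro i j
      refine Fin.cases ?_ (fun i => ?_) i <;> refine Fin.cases ?_ (fun j => ?_) j <;>
        simp [hss, hsv x hx, hzs y hy, hzv, Fin.succ_ne_zero, (Fin.succ_ne_zero _).symm])
  refine ⟨b, hb, ?_, ?_, ?_, ?_⟩
  · rw [hbx]
    simpa [s] using hsum _
  · rw [hby]
    simpa [s] using hsum _
  · intro i
    rw [hbx]
    exact hz i
  · intro i
    rw [hby]
    simpa [v] using hsum _

/-- Vectors on which the two forms `φ_x`, `φ_y` have the values prescribed by `P(β)` and on which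
all triple values vanish give a presentation `P(β)`. -/
theorem hasPresentation_of_triple_eq_zero (A : SymplecticAlternatingAlgebra F L)
    (hcube : A.power 3 ≤ A.center) (hdim : Module.finrank F L = 10) {β : F} {x y : L}
    (hx : x ∈ A.power 2) (hy : y ∈ A.power 2) (hxy : A.form x y = 1) (u : Fin 4 → L)
    (hxu : ∀ i j, i < j → A.form (A.mul x (u i)) (u j) =
      if (i, j) = (0, 1) then 1 else if (i, j) = (2, 3) then β else 0)
    (hyu : ∀ i j, i < j → A.form (A.mul y (u i)) (u j) =
      if (i, j) = (0, 3) ∨ (i, j) = (1, 2) then 1 else 0)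
    (huuu : ∀ i j k, i < j → j < k → A.form (A.mul (u i) (u j)) (u k) = 0) :
    A.HasPresentation β := by
  -- The family dual to `u`, read off from the matrix of `φ_y`.
  let z : Fin 4 → L := ![-A.mul y (u 3), -A.mul y (u 2), A.mul y (u 1), A.mul y (u 0)]
  have hz3 : ∀ i, z i ∈ A.power 3 := by
    have h := A.mul_mem_power_succ (n := 1) hy
    intro i
    fin_cases i
    · exact neg_mem (h _)
    · exact neg_mem (h _)
    · exact h _
    · exact h _
  have hzu : ∀ i j, A.form (z i) (u j) = if i = j then 1 else 0 := by
    have h01 := hyu 0 1 (by decide)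
    have h02 := hyu 0 2 (by decide)
    have h03 := hyu 0 3 (by decide)
    have h12 := hyu 1 2 (by decide)
    have h13 := hyu 1 3 (by decide)
    have h23 := hyu 2 3 (by decide)
    have h10 := A.form_mul_swap_right y (u 1) (u 0)
    have h20 := A.form_mul_swap_right y (u 2) (u 0)
    have h30 := A.form_mul_swap_right y (u 3) (u 0)
    have h21 := A.form_mul_swap_right y (u 2) (u 1)
    have h31 := A.form_mul_swap_right y (u 3) (u 1)
    have h32 := A.form_mul_swap_right y (u 3) (u 2)
    rw [h01] at h10
    rw [h02] at h20
    rw [h03] at h30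
    rw [h12] at h21
    rw [h13] at h31
    rw [h23] at h32
    intro i j
    fin_cases i <;> fin_cases j <;>
      simp [z, h01, h02, h03, h12, h13, h23, h10, h20, h30, h21, h31, h32, A.form_mul_self_right]
  obtain ⟨b, hb, hbx, hby, hbz, hbu⟩ := A.exists_standardBasis (n := 4) hdim hx hy hxy
    (fun i => hcube (hz3 i)) (fun i => A.power_three_le_power_two (hz3 i)) hzu
  have hxL : A.mul (b (.inl 0)) (b (.inr 0)) = 0 := by
    refine A.eq_of_form_eq fun w => ?_
    rw [A.form_mul_sub_center hbx hby (w := w) (by simp), A.triple_eq_zero hcube hx hy]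
    simp
  refine ⟨b, hb, ?_, ?_, ?_, ?_⟩
  · intro i j
    refine Fin.cases ?_ (fun i => ?_) i
    · refine Fin.cases (A.mul_self _) (fun j => ?_) j
      exact A.mul_center_right (hbz j) _
    · exact A.mul_center_left (hbz i) _
  · intro i j
    refine Fin.cases (fun hj => ?_) (fun i hj => ?_) i
    · obtain rfl : j = 0 := Fin.le_zero_iff.1 hj
      exact hxL
    · exact A.mul_center_left (hbz i) _
  · intro i j k
    refine Fin.cases ?_ (fun i => ?_) i
    · refine Fin.cases (fun h => absurd h (lt_irrefl _)) (fun j _ => ?_) j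
      refine Fin.cases (fun h => absurd h (Fin.not_lt_zero _)) (fun k hjk => ?_) k
      rw [A.form_mul_sub_center hbx (hbu j) (hbu k), hxu j k (Fin.succ_lt_succ_iff.1 hjk)]
      clear hjk
      revert j k
      simp [Fin.forall_fin_succ]
    · intro _ _
      rw [A.mul_center_left (hbz i)]
      simp [Fin.succ_ne_zero]
  · intro i j k hij
    have hj : j ≠ 0 := Fin.ne_zero_of_lt hij
    obtain ⟨j, rfl⟩ := Fin.exists_succ_eq.2 hj
    intro hjk
    obtain ⟨k, rfl⟩ := Fin.exists_succ_eq.2 (Fin.ne_zero_of_lt hjk)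
    rw [Fin.succ_lt_succ_iff] at hjk
    revert hij
    refine Fin.cases (fun _ => ?_) (fun i hij => ?_) i
    · rw [A.form_mul_sub_center hby (hbu j) (hbu k), hyu j k hjk]
      clear hjk
      revert j k
      simp [Fin.forall_fin_succ]
    · rw [A.form_mul_sub_center (hbu i) (hbu j) (hbu k),
        huuu i j k (Fin.succ_lt_succ_iff.1 hij) hjk]
      simp [Fin.succ_ne_zero]

/-- Vectors on which the two forms `φ_x`, `φ_y` have the values prescribed by `P(β)` give a
presentation `P(β)`. -/
theorem hasPresentation_of_vectors (A : SymplecticAlternatingAlgebra F L)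
    (hcube : A.power 3 ≤ A.center) (hdim : Module.finrank F L = 10) {β : F} {x y : L}
    (hx : x ∈ A.power 2) (hy : y ∈ A.power 2) (hxy : A.form x y = 1) (u : Fin 4 → L)
    (hxu : ∀ i j, i < j → A.form (A.mul x (u i)) (u j) =
      if (i, j) = (0, 1) then 1 else if (i, j) = (2, 3) then β else 0)
    (hyu : ∀ i j, i < j → A.form (A.mul y (u i)) (u j) =
      if (i, j) = (0, 3) ∨ (i, j) = (1, 2) then 1 else 0) :
    A.HasPresentation β := by
  let t : Fin 4 → Fin 4 → Fin 4 → F := fun i j k => A.form (A.mul (u i) (u j)) (u k)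
  -- Each triple of indices contains exactly one of the pairs `03`, `12` on which `φ_y` is 1, so its
  -- value is cancelled by the coefficient of the third index alone. Adding multiples of `y ∈ L²`
  -- leaves `φ_x` and `φ_y` unchanged.
  let l : Fin 4 → F := ![-t 0 1 2, t 0 1 3, t 0 2 3, -t 1 2 3]
  let u' : Fin 4 → L := fun i => u i + l i • y
  have hleft : ∀ w ∈ A.power 2, ∀ i j,
      A.form (A.mul w (u' i)) (u' j) = A.form (A.mul w (u i)) (u j) := by
    intro w hw i j
    simp [u', A.triple_eq_zero hcube hw hy, A.triple_eq_zero' hcube hw _ hy]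
  refine A.hasPresentation_of_triple_eq_zero hcube hdim hx hy hxy u' ?_ ?_ ?_
  · intro i j hij
    rw [hleft x hx, hxu i j hij]
  · intro i j hij
    rw [hleft y hy, hyu i j hij]
  · intro i j k hij hjk
    have key : A.form (A.mul (u' i) (u' j)) (u' k) =
        t i j k + l i * A.form (A.mul y (u j)) (u k) - l j * A.form (A.mul y (u i)) (u k) +
          l k * A.form (A.mul y (u i)) (u j) := by
      have e1 := A.triple_eq_zero hcube hy hy
      have e2 := A.triple_eq_zero' hcube hy (hv := hy)
      have e3 : ∀ a b, A.form (A.mul a y) b = -A.form (A.mul y a) b := fun a b =>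
        A.form_mul_swap a y b
      have e4 : ∀ a b, A.form (A.mul a b) y = A.form (A.mul y a) b := fun a b =>
        (A.form_mul y a b).symm
      simp [u', t, e1, e2, e3, e4]
      ring
    rw [key, hyu _ _ hij, hyu _ _ hjk, hyu _ _ (hij.trans hjk)]
    fin_cases i <;> fin_cases j <;> first | (exfalso; revert hij; decide) | skip
    all_goals fin_cases k <;> first | (exfalso; revert hjk; decide) | simp [l]

/-! ### Algebras of type C have a presentation -/

namespace IsTypeC

variable {A : SymplecticAlternatingAlgebra F L}

theorem ne_neg_sq {β : F} (hA : A.IsTypeC) (h : A.HasPresentation β) (c : F) : β ≠ -c ^ 2 := by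
  rintro rfl
  have hC := hA.of_isIsomorphic ((model_hasPresentation _).isIsomorphic h)
  -- `x₁ + cy₁` is a zero of `βa² + b²` when `β = -c²`; `cy₂ + y₄` lies in the radical of its form.
  let z : Fin 5 ⊕ Fin 5 → F := Sum.elim ![1, 0, 0, 0, 0] ![c, 0, 0, 0, 0]
  have hz : z ∈ (model (-c ^ 2)).power 2 := by
    rw [model_mem_power_two_iff]
    intro i
    fin_cases i <;> simp [z]
  have hzc : z ∉ (model (-c ^ 2)).center := by
    rw [model_mem_center_iff]
    simp [z]
  have hn := hC.phi_nondegenerate ⟨z, hz⟩ hzc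
  rw [phi_nondegenerate_iff] at hn
  have hu := hn (Sum.elim 0 ![0, c, 0, 1, 0]) (by
    rw [model_mul_apply]
    ext (i | i) <;> fin_cases i <;> simp [modelProd, z]
    ring)
  rw [model_mem_power_two_iff] at hu
  simpa using hu 2

theorem exists_hyperbolic_pair (hA : A.IsTypeC) :
    ∃ x ∈ A.power 2, ∃ y ∈ A.power 2, A.form x y = 1 := by
  have hx : ∃ x ∈ A.power 2, x ∉ A.center := by
    by_contra! hle
    have h3 : A.power 3 = ⊥ := by
      rw [eq_bot_iff]
      refine Submodule.map₂_le.2 fun u hu v _ => ?_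
      rw [Submodule.mem_bot]
      exact A.mul_center_left (hle u hu) v
    have := hA.finrank_center
    rw [← hA.cube_eq_center, h3, finrank_bot] at this
    omega
  obtain ⟨x, hx, hxc⟩ := hx
  rw [mem_center_iff_forall_form] at hxc
  push Not at hxc
  obtain ⟨y, hy, hxy⟩ := hxc
  exact ⟨x, hx, (A.form x y)⁻¹ • y, Submodule.smul_mem _ _ hy, by simp [hxy]⟩

theorem finrank_power_two (hA : A.IsTypeC) : Module.finrank F (A.power 2) = 6 := by
  have hfin : FiniteDimensional F L :=
    Module.finite_of_finrank_pos (by rw [hA.finrank_eq]; norm_num)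
  have ho : A.form.orthogonal (A.power 2) = A.center := by
    ext w
    rw [mem_center_iff_forall_form, LinearMap.BilinForm.mem_orthogonal_iff]
    refine forall₂_congr fun z _ => ?_
    rw [A.form_swap, neg_eq_zero]
  have h := LinearMap.BilinForm.finrank_orthogonal A.form_nondegenerate (A.power 2)
  rw [ho, hA.finrank_center, hA.finrank_eq] at h
  omega

/-- Multiplication by `y` has kernel `L²`, of dimension 6, so its range has dimension 4 and fills
the centre. This is what defines `T = φ_y⁻¹φ_x`. -/
theorem exists_mul_eq (hA : A.IsTypeC) {y w : L} (hy : y ∈ A.power 2) (hyc : y ∉ A.center)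
    (hw : w ∈ A.center) : ∃ u, A.mul y u = w := by
  have hfin : FiniteDimensional F L :=
    Module.finite_of_finrank_pos (by rw [hA.finrank_eq]; norm_num)
  have hker : LinearMap.ker (A.mul y) = A.power 2 := by
    refine le_antisymm (fun u hu => ?_) fun u hu => ?_
    · exact (A.phi_nondegenerate_iff _ ⟨y, hy⟩).1 (hA.phi_nondegenerate ⟨y, hy⟩ hyc) u hu
    · refine A.eq_of_form_eq fun v => ?_
      rw [A.triple_eq_zero hA.cube_eq_center.le hy hu]
      simp
  have hle : LinearMap.range (A.mul y) ≤ A.center := by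
    rintro _ ⟨u, rfl⟩
    exact hA.cube_eq_center.le (A.mul_mem_power_succ (n := 1) hy u)
  have hrank := LinearMap.finrank_range_add_finrank_ker (A.mul y)
  rw [hker, hA.finrank_power_two, hA.finrank_eq] at hrank
  have heq := Submodule.eq_of_le_of_finrank_eq hle (by rw [hA.finrank_center]; omega)
  rw [← heq] at hw
  exact hw

theorem exists_hasPresentation (hF : (2 : F) ≠ 0) (hA : A.IsTypeC) :
    ∃ β : F, A.HasPresentation β := by
  obtain ⟨x, hx, y, hy, hxy⟩ := hA.exists_hyperbolic_pair
  have hyx : A.form y x = -1 := by rw [A.form_swap, hxy]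
  have hyc : y ∉ A.center := fun h => by
    have := A.form_center_square h hx
    rw [hyx] at this
    simp at this
  obtain ⟨v, hv⟩ : ∃ v, v ∉ A.power 2 := by
    by_contra! h
    have h6 := hA.finrank_power_two
    rw [(Submodule.eq_top_iff').2 h, finrank_top, hA.finrank_eq] at h6
    omega
  have hdiv : ∀ u, ∃ u', A.mul y u' = A.mul x u := fun u =>
    hA.exists_mul_eq hy hyc (hA.cube_eq_center.le (A.mul_mem_power_succ (n := 1) hx u))
  obtain ⟨v', hv'⟩ := hdiv v
  have hyv : A.mul y v ≠ 0 := fun h => hv <|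
    (A.phi_nondegenerate_iff _ ⟨y, hy⟩).1 (hA.phi_nondegenerate ⟨y, hy⟩ hyc) v h
  obtain ⟨w₀, hw₀⟩ : ∃ w₀, A.form (A.mul y v) w₀ ≠ 0 := by
    by_contra! h
    exact hyv (A.form_nondegenerate.1 _ h)
  -- Otherwise `v' = Tv` would be a multiple `kv` modulo `L²`, putting `v` in the radical of `φ_{x -
  -- ky}` against type C.
  obtain ⟨w₁, hw₁, hw₁'⟩ : ∃ w, A.form (A.mul y v) w = 0 ∧ A.form (A.mul y v') w ≠ 0 := by
    by_contra! h
    let k := A.form (A.mul y v') w₀ / A.form (A.mul y v) w₀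
    have hk : A.mul y v' = A.mul y (k • v) := by
      refine A.eq_of_form_eq fun w => ?_
      have := h (w - (A.form (A.mul y v) w / A.form (A.mul y v) w₀) • w₀) (by simp [hw₀])
      simp only [map_sub, map_smul, smul_eq_mul, LinearMap.smul_apply] at this ⊢
      rw [sub_eq_zero] at this
      rw [this]
      simp only [k]
      ring
    have hzc : x - k • y ∉ A.center := fun hc => by
      have := A.form_center_square hc hy
      simp [hxy, A.form_self] at this
    have hz : x - k • y ∈ A.power 2 := sub_mem hx (Submodule.smul_mem _ _ hy)
    refine hv ((A.phi_nondegenerate_iff _ ⟨_, hz⟩).1 (hA.phi_nondegenerate ⟨_, hz⟩ hzc) v ?_)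
    simp [← hv', hk]
  let w := (A.form (A.mul y v') w₁)⁻¹ • w₁
  have hvw : A.form (A.mul y v) w = 0 := by simp [w, hw₁]
  have hv'w : A.form (A.mul y v') w = 1 := by simp [w, hw₁']
  obtain ⟨w', hw'⟩ := hdiv w
  let s := A.form (A.mul y v') w'
  let r := A.form (A.mul x v') w'
  have sw := A.form_mul_swap_right
  have y_vw' : A.form (A.mul y v) w' = 1 := by rw [sw, hw', ← sw, ← hv', hv'w]
  have y_vv' : A.form (A.mul y v) v' = 0 := by
    rw [sw, hv', A.form_mul_self_right, neg_zero]
  have y_ww' : A.form (A.mul y w) w' = 0 := by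
    rw [sw, hw', A.form_mul_self_right, neg_zero]
  have x_vw : A.form (A.mul x v) w = 1 := by rw [← hv', hv'w]
  have x_vw' : A.form (A.mul x v) w' = s := by rw [← hv']
  have x_vv' : A.form (A.mul x v) v' = 0 := by rw [← hv', A.form_mul_self_right]
  have x_ww' : A.form (A.mul x w) w' = 0 := by rw [← hw', A.form_mul_self_right]
  have x_wv' : A.form (A.mul x w) v' = -s := by rw [← hw', sw]
  have x_v'w' : A.form (A.mul x v') w' = r := rfl
  have y_v'w' : A.form (A.mul y v') w' = s := rfl
  have y_wv' : A.form (A.mul y w) v' = -1 := by rw [sw, hv'w]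
  have y_wv : A.form (A.mul y w) v = 0 := by rw [sw, hvw, neg_zero]
  have x_wv : A.form (A.mul x w) v = -1 := by rw [sw, x_vw]
  have x_v'w : A.form (A.mul x v') w = s := by rw [sw, x_wv', neg_neg]
  have diag := A.form_mul_self_right
  -- If `T² = sT - d`, then `r = φ_y(T³v, w) = s² - d`, and `T₀ = T - s/2` has `T₀² = s²/4 - d =
  -- -(3s²/4 - r)`. The vectors are `v, w, -T₀v, T₀w`.
  refine ⟨3 * s ^ 2 / 4 - r, A.hasPresentation_of_vectors hA.cube_eq_center.le hA.finrank_eq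
    (x := x - (s / 2) • y) (y := y) (sub_mem hx (Submodule.smul_mem _ _ hy)) hy
    (by simp [hxy, A.form_self]) ![v, w, (s / 2) • v - v', w' - (s / 2) • w] ?_ ?_⟩
  · have h4 : (4 : F) ≠ 0 := by
      have : (4 : F) = 2 * 2 := by norm_num
      rw [this]
      exact mul_ne_zero hF hF
    intro i j hij
    fin_cases i <;> fin_cases j <;> first | (exfalso; revert hij; decide) | skip
    all_goals
      simp [hvw, hv'w, y_vw', y_vv', y_ww', x_vw, x_vw', x_vv', x_ww', x_wv', x_v'w', y_v'w',
        y_wv', y_wv, x_wv, x_v'w, diag]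
    all_goals try field_simp
    all_goals ring
  · intro i j hij
    fin_cases i <;> fin_cases j <;> first | (exfalso; revert hij; decide) | skip
    all_goals
      simp [hvw, hv'w, y_vw', y_vv', y_ww', y_v'w', y_wv', y_wv, diag]
    field_simp
    ring

end IsTypeC

/-! ### The isomorphism criterion -/

/-- The new pair `ax₁ - βby₁`, `(bx₁ + ay₁)/N` has determinant 1 and is orthogonal for `βp² + q²`,
whose values on it are `βN` and `1/N`; their quotient is `βN²`. -/
theorem model_hasPresentation_mul_sq {β a b : F} (hN : a ^ 2 + b ^ 2 * β ≠ 0) :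
    (model β).HasPresentation (β * (a ^ 2 + b ^ 2 * β) ^ 2) := by
  set N := a ^ 2 + b ^ 2 * β with hNdef
  refine (model β).hasPresentation_of_vectors (model_power_three β).le (by simp)
    (x := Sum.elim ![a, 0, 0, 0, 0] ![-(β * b), 0, 0, 0, 0])
    (y := Sum.elim ![b / N, 0, 0, 0, 0] ![a / N, 0, 0, 0, 0]) ?_ ?_ ?_
    ![Sum.elim 0 ![0, 1, 0, 0, 0], Sum.elim 0 ![0, 0, a / N, 0, -b / N],
      Sum.elim 0 ![0, 0, 0, N, 0], Sum.elim 0 ![0, 0, b * β, 0, a]] ?_ ?_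
  · rw [model_mem_power_two_iff]
    intro i
    fin_cases i <;> simp
  · rw [model_mem_power_two_iff]
    intro i
    fin_cases i <;> simp
  · simp [model_form_apply, Fin.sum_univ_five]
    field_simp
    rw [hNdef]
    ring
  · intro i j hij
    rw [model_mul_apply, model_form_apply, Fin.sum_univ_five]
    fin_cases i <;> fin_cases j <;> first | (exfalso; revert hij; decide) | skip
    all_goals simp [modelProd]
    all_goals try field_simp
    all_goals try rw [hNdef]
    all_goals first | ring1 | (left; ring1)
  · intro i j hij
    rw [model_mul_apply, model_form_apply, Fin.sum_univ_five]
    fin_cases i <;> fin_cases j <;> first | (exfalso; revert hij; decide) | skip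
    all_goals simp [modelProd]
    all_goals try field_simp
    all_goals try rw [hNdef]
    all_goals ring

/-- The determinant of a `4 × 4` matrix, expanded along its first two rows. -/
def laplaceDet (g : Fin 4 → Fin 4 → F) : F :=
  let m : Fin 4 → Fin 4 → Fin 4 → Fin 4 → F := fun i j k l => g i k * g j l - g j k * g i l
  m 0 1 0 1 * m 2 3 2 3 - m 0 1 0 2 * m 2 3 1 3 + m 0 1 0 3 * m 2 3 1 2 +
    m 0 1 1 2 * m 2 3 0 3 - m 0 1 1 3 * m 2 3 0 2 + m 0 1 2 3 * m 2 3 0 1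

/-- The alternating form on `F⁴` which is `a φ_{x₁} + b φ_{y₁}` in the model of `P(β)`. -/
def pencil (β a b : F) (u v : Fin 4 → F) : F :=
  a * ((u 0 * v 1 - v 0 * u 1) + β * (u 2 * v 3 - v 2 * u 3)) +
    b * ((u 0 * v 3 - v 0 * u 3) + (u 1 * v 2 - v 1 * u 2))

/-- The identity `Pf(gMgᵀ) = det(g) Pf(M)`, for the pencil. -/
theorem pfaffian_pencil (β a b : F) (g : Fin 4 → Fin 4 → F) :
    pencil β a b (g 0) (g 1) * pencil β a b (g 2) (g 3) -
        pencil β a b (g 0) (g 2) * pencil β a b (g 1) (g 3) +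
        pencil β a b (g 0) (g 3) * pencil β a b (g 1) (g 2) =
      laplaceDet g * (β * a ^ 2 + b ^ 2) := by
  simp only [pencil, laplaceDet]
  ring

theorem model_form_mul (β : F) {z : Fin 5 ⊕ Fin 5 → F} (hz : z ∈ (model β).power 2)
    (u v : Fin 5 ⊕ Fin 5 → F) :
    (model β).form ((model β).mul z u) v =
      pencil β (z (.inl 0)) (z (.inr 0)) (fun i => u (.inr i.succ)) (fun i => v (.inr i.succ)) := by
  rw [model_mem_power_two_iff] at hz
  have h1 := hz 0
  have h2 := hz 1
  have h3 := hz 2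
  have h4 := hz 3
  simp only [Fin.isValue, Fin.succ_zero_eq_one, Fin.reduceSucc] at h1 h2 h3 h4
  rw [model_mul_apply, model_form_apply, Fin.sum_univ_five]
  simp [modelProd, pencil, h1, h2, h3, h4]
  ring

theorem exists_of_model_isIsomorphic (hF : (2 : F) ≠ 0) {β β' : F} (hβ : β ≠ 0)
    (h : (model β).IsIsomorphic (model β')) :
    ∃ a b : F, (a, b) ≠ (0, 0) ∧ β' / β = (a ^ 2 + b ^ 2 * β) ^ 2 := by
  obtain ⟨e, hf, hm⟩ := h
  let x : Fin 5 ⊕ Fin 5 → F := Pi.single (.inl 0) 1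
  let y : Fin 5 → Fin 5 ⊕ Fin 5 → F := fun i => Pi.single (.inr i) 1
  have hx2 : x ∈ (model β).power 2 := by simp [model_mem_power_two_iff, x]
  have hy2 : y 0 ∈ (model β).power 2 := by simp [model_mem_power_two_iff, y]
  let g : Fin 4 → Fin 4 → F := fun i j => e (y i.succ) (.inr j.succ)
  have key : ∀ z ∈ (model β).power 2, ∀ i j : Fin 4,
      pencil β' (e z (.inl 0)) (e z (.inr 0)) (g i) (g j) =
        pencil β (z (.inl 0)) (z (.inr 0)) (Pi.single i 1) (Pi.single j 1) := by
    intro z hz i j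
    have h1 := model_form_mul β' ((apply_mem_power_iff hm).2 hz) (e (y i.succ)) (e (y j.succ))
    rw [← hm, hf, model_form_mul β hz] at h1
    rw [← h1]
    congr 1 <;> ext k <;> simp [y, Pi.single_apply]
  have pf : ∀ z ∈ (model β).power 2,
      β * z (.inl 0) ^ 2 + z (.inr 0) ^ 2 =
        laplaceDet g * (β' * e z (.inl 0) ^ 2 + e z (.inr 0) ^ 2) := by
    intro z hz
    rw [← pfaffian_pencil]
    simp only [key z hz]
    simp [pencil]
    ring
  have hxx := pf x hx2
  have hyy := pf (y 0) hy2
  have hxy := pf (x + y 0) (add_mem hx2 hy2)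
  have hone : (model β').form (e x) (e (y 0)) = 1 := by
    rw [hf]
    simp [model_form_apply, Fin.sum_univ_five, x, y]
  have hx0 := (model_mem_power_two_iff β').1 ((apply_mem_power_iff hm).2 hx2)
  have hy0 := (model_mem_power_two_iff β').1 ((apply_mem_power_iff hm).2 hy2)
  rw [model_form_apply, Fin.sum_univ_succ] at hone
  simp only [hx0, hy0] at hone
  simp only [mul_zero, zero_mul, sub_zero, Finset.sum_const_zero, add_zero] at hone
  rw [map_add] at hxy
  simp only [Pi.add_apply] at hxy
  generalize e x (.inl 0) = p at *
  generalize e x (.inr 0) = q at *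
  generalize e (y 0) (.inl 0) = r at *
  generalize e (y 0) (.inr 0) = s at *
  generalize laplaceDet g = δ at *
  simp [x, y] at hxx hyy hxy
  have hδ : δ ≠ 0 := by
    rintro rfl
    simp at hyy
  -- Polarisation of the Pfaffian identity at `x₁`, `y₁` and their sum.
  have horth : β' * p * r + q * s = 0 := by
    have : (2 * δ) * (β' * p * r + q * s) = 0 := by
      linear_combination hxx + hyy - hxy
    exact (mul_eq_zero_iff_left (mul_ne_zero hF hδ)).1 this
  set D := β' * r ^ 2 + s ^ 2 with hD
  have hβ' : β' = β * D ^ 2 := by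
    -- Brahmagupta's identity; it compares the discriminants, since `ps - qr = 1`.
    have h1 : β' * (p * s - q * r) ^ 2 + (β' * p * r + q * s) ^ 2 =
        (β' * p ^ 2 + q ^ 2) * D := by rw [hD]; ring
    rw [hone, horth] at h1
    have h2 : β' * p ^ 2 + q ^ 2 = β * D := by
      apply mul_left_cancel₀ hδ
      linear_combination β * hyy - hxx
    rw [h2] at h1
    linear_combination h1
  have hDN : D = s ^ 2 + (D * r) ^ 2 * β := by
    linear_combination hD + r ^ 2 * hβ'
  refine ⟨s, D * r, ?_, ?_⟩
  · intro h
    simp only [Prod.mk.injEq] at h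
    rw [h.1, h.2] at hDN
    simp only [ne_eq, OfNat.ofNat_ne_zero, not_false_eq_true, zero_pow, zero_mul,
      add_zero] at hDN
    rw [hDN] at hyy
    simp at hyy
  · rw [← hDN, div_eq_iff hβ, hβ']
    ring

end SymplecticAlternatingAlgebra

theorem proposition2p8 {F : Type*} [Field F] (hF : ringChar F ≠ 2) :
    -- every algebra of type C has a presentation `P(β)` with `β ∉ -F²`
    (∀ (L : Type*) [AddCommGroup L] [Module F L] (A : SymplecticAlternatingAlgebra F L),
      A.IsTypeC → ∃ β : F, (∀ c : F, β ≠ -c ^ 2) ∧ A.HasPresentation β) ∧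
    -- each such presentation is the presentation of some algebra, and gives an algebra of type C
    (∀ β : F, (∀ c : F, β ≠ -c ^ 2) →
      (∃ A : SymplecticAlternatingAlgebra F (Fin 5 ⊕ Fin 5 → F), A.HasPresentation β) ∧
      ∀ (L : Type*) [AddCommGroup L] [Module F L] (A : SymplecticAlternatingAlgebra F L),
        A.HasPresentation β → A.IsTypeC) ∧
    -- two such presentations describe the same algebra iff `β' / β = (a² + b²β)²`
    (∀ β β' : F, (∀ c : F, β ≠ -c ^ 2) → (∀ c : F, β' ≠ -c ^ 2) →
      ∀ (L L' : Type*) [AddCommGroup L] [Module F L] [AddCommGroup L'] [Module F L']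
        (A : SymplecticAlternatingAlgebra F L) (A' : SymplecticAlternatingAlgebra F L'),
        A.HasPresentation β → A'.HasPresentation β' →
        (A.IsIsomorphic A' ↔
          ∃ a b : F, (a, b) ≠ (0, 0) ∧ β' / β = (a ^ 2 + b ^ 2 * β) ^ 2)) := by
  have h2 : (2 : F) ≠ 0 := Ring.two_ne_zero hF
  open SymplecticAlternatingAlgebra in
  refine ⟨fun L _ _ A hA => ?_, fun β hβ => ⟨⟨model β, model_hasPresentation β⟩,
    fun L _ _ A hA => ?_⟩, fun β β' hβ hβ' L L' _ _ _ _ A A' hA hA' => ⟨fun h => ?_, ?_⟩⟩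
  · obtain ⟨β, hβ⟩ := hA.exists_hasPresentation h2
    exact ⟨β, hA.ne_neg_sq hβ, hβ⟩
  · exact (model_isTypeC hβ).of_isIsomorphic (hA.isIsomorphic (model_hasPresentation β))
  · exact exists_of_model_isIsomorphic h2 (by simpa using hβ 0)
      (((model_hasPresentation β).isIsomorphic hA).trans
        (h.trans (hA'.isIsomorphic (model_hasPresentation β'))))
  · rintro ⟨a, b, hab, h⟩
    have hβ0 : β ≠ 0 := by simpa using hβ 0
    rw [div_eq_iff hβ0, mul_comm] at h
    have hm := model_hasPresentation_mul_sq (add_sq_mul_ne_zero hβ hab)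
    rw [← h] at hm
    exact (hA.isIsomorphic (model_hasPresentation β)).trans (hm.isIsomorphic hA')
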